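/- Let $X$ be a compact metric space. Let $\Gamma(X)$ be the set of all homeomorphisms $f:\mathrm{dom}(f)\to\mathrm{im}(f)$ between open subsets of $X$ (including the empty map); for $A\subseteq X$ write $f[A]=\{f(x):x\in A\cap\mathrm{dom}(f)\}$. Equip $\Gamma(X)$ with the topology $\tau_{hco}$: the smallest topology which contains all sets $$\langle K;V\rangle=\{f: K\subseteq \mathrm{dom}(f),\ f[K]\subseteq V\},\qquad \langle K;V\rangle^{-1}=\{f: K\subseteq f[V]\}$$ with $K\subseteq X$ compact and $V\subseteq X$ open, and for which the maps $f\mapsto X\setminus\mathrm{dom}(f)$ and $f\mapsto X\setminus\mathrm{im}(f)$ into the closed subsets of $X$ are continuous. Here the collection of closed subsets of $X$ (including $\emptyset$) carries the Fell topology, which has as a subbasis the sets $\{A: A\cap V\neq\emptyset\}$ with $V$ open and $\{A: A\subseteq W\}$ with $W$ open and $X\setminus W$ compact. Let $\mathcal B$ be a countable base of open sets for the topology of $X$ that contains $\emptyset$ and is closed under finite unions and finite intersections, and let $$\Gamma(X,\mathcal B)=\{f\in\Gamma(X): f[u]\in\mathcal B \text{ and } f^{-1}[v]\in\mathcal B\text{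 for all } u,v\in\mathcal B \text{ with } u\subseteq\mathrm{dom}(f),\ v\subseteq\mathrm{im}(f)\}.$$ Then $\Gamma(X,\mathcal B)$, with the subspace topology inherited from $(\Gamma(X),\tau_{hco})$, is standard Borel: $\Gamma(X,\mathcal B)$ with the $\sigma$-algebra of Borel sets of this topology is isomorphic, as a measurable space, to a Polish space with its Borel $\sigma$-algebra. -/

import Mathlib

/-- A partial homeomorphism of `X`: a homeomorphism between two open subsets `dom` and `im` of `X`.
The type `PartialHomeo X` is `Γ(X)`. The map is defined on `dom` only, so two elements are equal
exactly when they have the same domain and the same values on it. -/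
structure PartialHomeo (X : Type*) [TopologicalSpace X] where
  dom : TopologicalSpace.Opens X
  im : TopologicalSpace.Opens X
  toHomeomorph : dom ≃ₜ im

/-- The Fell topology on the collection `CL(X)` of all closed subsets of `X` (including `∅`):
it has as a subbasis the sets `{A | A ∩ V ≠ ∅}` for `V` open and the sets `{A | A ⊆ W}`
for `W` open with compact complement. -/
@[reducible] def fellTopology (X : Type*) [TopologicalSpace X] :
    TopologicalSpace (TopologicalSpace.Closeds X) :=
  TopologicalSpace.generateFrom
    ({S | ∃ V : Set X, IsOpen V ∧ S = {A : TopologicalSpace.Closeds X | ((A : Set X) ∩ V).Nonempty}} ∪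
      {S | ∃ W : Set X, IsOpen W ∧ IsCompact Wᶜ ∧
        S = {A : TopologicalSpace.Closeds X | (A : Set X) ⊆ W}})

namespace PartialHomeo

/-- The inverse partial homeomorphism `f⁻¹ : im f → dom f`. -/
def symm {X : Type*} [TopologicalSpace X] (f : PartialHomeo X) : PartialHomeo X where
  dom := f.im
  im := f.dom
  toHomeomorph := f.toHomeomorph.symm

/-- The direct image `f[A] = {f(x) : x ∈ A ∩ dom f}`. -/
def image {X : Type*} [TopologicalSpace X] (f : PartialHomeo X) (A : Set X) : Set X :=
  {y | ∃ x : f.dom, (x : X) ∈ A ∧ (f.toHomeomorph x : X) = y}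

/-- `⟨K; V⟩ = {f ∈ Γ(X) : K ⊆ dom f and f[K] ⊆ V}`. -/
def compactOpen {X : Type*} [TopologicalSpace X] (K V : Set X) : Set (PartialHomeo X) :=
  {f | K ⊆ (f.dom : Set X) ∧ f.image K ⊆ V}

/-- `⟨K; V⟩⁻¹ = {f ∈ Γ(X) : K ⊆ f[V]}`. -/
def compactOpenInv {X : Type*} [TopologicalSpace X] (K V : Set X) : Set (PartialHomeo X) :=
  {f | K ⊆ f.image V}

/-- The topology `τ_co` on `Γ(X)`, generated by all `⟨K; V⟩` and `⟨K; V⟩⁻¹` with `K` compact and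
`V` open. -/
@[reducible] def tauCO (X : Type*) [TopologicalSpace X] : TopologicalSpace (PartialHomeo X) :=
  TopologicalSpace.generateFrom
    ({S | ∃ K V : Set X, IsCompact K ∧ IsOpen V ∧ S = compactOpen K V} ∪
      {S | ∃ K V : Set X, IsCompact K ∧ IsOpen V ∧ S = compactOpenInv K V})

/-- `D(f) = X \ dom f`, a closed subset of `X`. -/
def domCompl {X : Type*} [TopologicalSpace X] (f : PartialHomeo X) :
    TopologicalSpace.Closeds X :=
  f.dom.compl

/-- `I(f) = X \ im f`, a closed subset of `X`. -/
def imCompl {X : Type*} [TopologicalSpace X] (f : PartialHomeo X) :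
    TopologicalSpace.Closeds X :=
  f.im.compl

/-- The topology `τ_hco` on `Γ(X)`: the smallest topology that contains `τ_co` and makes `D` and
`I` continuous, where the closed subsets of `X` carry the Fell topology. (In Mathlib's order on
topologies the smallest common refinement is the infimum.) -/
instance tauHCO {X : Type*} [TopologicalSpace X] : TopologicalSpace (PartialHomeo X) :=
  tauCO X ⊓ TopologicalSpace.induced domCompl (fellTopology X) ⊓
    TopologicalSpace.induced imCompl (fellTopology X)

/-- `Γ(X, B)`: the partial homeomorphisms `f` such that `f[u] ∈ B` and `f⁻¹[v] ∈ B` for all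
`u, v ∈ B` with `u ⊆ dom f` and `v ⊆ im f`. -/
def basePreserving {X : Type*} [TopologicalSpace X] (B : Set (Set X)) : Set (PartialHomeo X) :=
  {f | ∀ u ∈ B, ∀ v ∈ B, u ⊆ (f.dom : Set X) → v ⊆ (f.im : Set X) →
    f.image u ∈ B ∧ f.symm.image v ∈ B}

end PartialHomeo

open TopologicalSpace Set
open scoped Topology MeasureTheory

/-! A partial homeomorphism `f` is encoded by a relation on the countable set `B`: `u` and `v` are
related when the closure of `u` lies in `f⁻¹[v]`. The codes of `f` and of `f⁻¹` together give an
injection `codePair` of `Γ(X)` into a countable power of `Prop`, a standard Borel space.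

Its range is Borel: by `range_codePair`, a pair of relations comes from some `f` exactly when it
satisfies the conditions `IsCode` and `IsLeftInverseCode`, which quantify over `B` only. The
substance is `IsCode.exists_value`, where compactness produces the value at a point from an abstract
code.

The Borel σ-algebra of `τ_hco` is the one pulled back by `codePair`
(`borel_eq_codeMeasurableSpace`): the basic conditions on codes are open, and `τ_hco` is coarser
than a topology with a countable subbasis of code-measurable sets. So `Γ(X)` is standard Borel.
Membership in `Γ(X, B)` is again a condition with quantifiers over `B`, so `Γ(X, B)` is a Borel
subset and inherits the property. -/

/-- A lattice of sets which is a countable base of the topology. -/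
structure IsLatticeBasis {X : Type*} [TopologicalSpace X] (B : Set (Set X)) : Prop where
  basis : IsTopologicalBasis B
  countable : B.Countable
  empty_mem : ∅ ∈ B
  union_mem : ∀ u ∈ B, ∀ v ∈ B, u ∪ v ∈ B
  inter_mem : ∀ u ∈ B, ∀ v ∈ B, u ∩ v ∈ B

namespace IsLatticeBasis

variable {X : Type*} [MetricSpace X] {B : Set (Set X)}

/-- Between a compact set and an open neighbourhood of it lies the closure of a basic set. -/
theorem exists_between (hB : IsLatticeBasis B) {K V : Set X} (hK : IsCompact K) (hV : IsOpen V)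
    (hKV : K ⊆ V) : ∃ w ∈ B, K ⊆ w ∧ closure w ⊆ V := by
  have key : ∃ w ∈ B, ∃ K' ⊇ K, K' ⊆ w ∧ closure w ⊆ V := by
    refine hK.induction_on (p := fun s => ∃ w ∈ B, ∃ K' ⊇ s, K' ⊆ w ∧ closure w ⊆ V)
      ⟨∅, hB.empty_mem, ∅, Subset.rfl, Subset.rfl, by simp⟩ ?_ ?_ ?_
    · rintro s t hst ⟨w, hw, K', h1, h2⟩
      exact ⟨w, hw, K', hst.trans h1, h2⟩
    · rintro s t ⟨w, hw, K', h1, h2, h3⟩ ⟨w', hw', K'', h1', h2', h3'⟩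
      refine ⟨w ∪ w', hB.union_mem _ hw _ hw', K' ∪ K'', union_subset_union h1 h1',
        union_subset_union h2 h2', ?_⟩
      rw [closure_union]
      exact union_subset h3 h3'
    · intro x hx
      obtain ⟨w, ⟨hw, hxw⟩, hwV⟩ := (hB.basis.nhds_hasBasis.nhds_closure.mem_iff).1
        (hV.mem_nhds (hKV hx))
      exact ⟨w, mem_nhdsWithin_of_mem_nhds (hB.basis.mem_nhds hw hxw), w, hw, w, Subset.rfl,
        Subset.rfl, hwV⟩
  obtain ⟨w, hw, K', h1, h2, h3⟩ := key
  exact ⟨w, hw, h1.trans h2, h3⟩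

theorem univ_mem [CompactSpace X] (hB : IsLatticeBasis B) : univ ∈ B := by
  obtain ⟨w, hw, h, -⟩ := hB.exists_between isCompact_univ isOpen_univ Subset.rfl
  rwa [univ_subset_iff.1 h] at hw

end IsLatticeBasis

/-! ### Preimages under partial homeomorphisms -/

namespace PartialHomeo

variable {X : Type*}

section TopologicalSpace

variable [TopologicalSpace X]

/-- The preimage `{x ∈ dom f : f(x) ∈ V}`. -/
def preimage (f : PartialHomeo X) (V : Set X) : Set X :=
  {x | ∃ h : x ∈ f.dom, (f.toHomeomorph ⟨x, h⟩ : X) ∈ V}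

theorem image_eq_preimage_symm (f : PartialHomeo X) (V : Set X) :
    f.image V = f.symm.preimage V := by
  ext y
  constructor
  · rintro ⟨x, hx, rfl⟩
    refine ⟨(f.toHomeomorph x).2, ?_⟩
    change (f.toHomeomorph.symm (f.toHomeomorph x) : X) ∈ V
    rwa [f.toHomeomorph.symm_apply_apply]
  · rintro ⟨h, hy⟩
    exact ⟨f.toHomeomorph.symm ⟨y, h⟩, hy, by simp⟩

theorem preimage_univ (f : PartialHomeo X) : f.preimage univ = f.dom := by
  ext x
  exact ⟨fun h => h.1, fun h => ⟨h, trivial⟩⟩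

theorem preimage_mono (f : PartialHomeo X) {V W : Set X} (h : V ⊆ W) :
    f.preimage V ⊆ f.preimage W :=
  fun _ hx => ⟨hx.1, h hx.2⟩

theorem preimage_empty (f : PartialHomeo X) : f.preimage ∅ = ∅ := by
  ext x
  exact ⟨fun h => h.2, fun h => h.elim⟩

theorem preimage_inter (f : PartialHomeo X) (V W : Set X) :
    f.preimage (V ∩ W) = f.preimage V ∩ f.preimage W := by
  ext x
  exact ⟨fun h => ⟨⟨h.1, h.2.1⟩, ⟨h.1, h.2.2⟩⟩, fun h => ⟨h.1.1, h.1.2, h.2.2⟩⟩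

theorem preimage_union (f : PartialHomeo X) (V W : Set X) :
    f.preimage (V ∪ W) = f.preimage V ∪ f.preimage W := by
  ext x
  constructor
  · rintro ⟨h, h' | h'⟩
    exacts [Or.inl ⟨h, h'⟩, Or.inr ⟨h, h'⟩]
  · rintro (⟨h, h'⟩ | ⟨h, h'⟩)
    exacts [⟨h, Or.inl h'⟩, ⟨h, Or.inr h'⟩]

theorem isOpen_preimage (f : PartialHomeo X) {V : Set X} (hV : IsOpen V) :
    IsOpen (f.preimage V) := by
  have h : IsOpen {x : f.dom | (f.toHomeomorph x : X) ∈ V} :=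
    hV.preimage (continuous_subtype_val.comp f.toHomeomorph.continuous)
  convert f.dom.isOpen.isOpenMap_subtype_val _ h using 1
  ext x
  simp [preimage]

theorem image_subset_iff {f : PartialHomeo X} {K V : Set X} (hK : K ⊆ f.dom) :
    f.image K ⊆ V ↔ K ⊆ f.preimage V := by
  constructor
  · exact fun h x hx => ⟨hK hx, h ⟨⟨x, hK hx⟩, hx, rfl⟩⟩
  · rintro h _ ⟨x, hx, rfl⟩
    exact (h hx).2

theorem mem_compactOpen {f : PartialHomeo X} {K V : Set X} :
    f ∈ compactOpen K V ↔ K ⊆ f.preimage V := by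
  constructor
  · exact fun h => (image_subset_iff h.1).1 h.2
  · intro h
    have hK : K ⊆ f.dom := fun x hx => (h hx).1
    exact ⟨hK, (image_subset_iff hK).2 h⟩

theorem mem_compactOpenInv {f : PartialHomeo X} {K V : Set X} :
    f ∈ compactOpenInv K V ↔ K ⊆ f.symm.preimage V := by
  rw [← image_eq_preimage_symm]
  rfl

theorem isCompact_image {f : PartialHomeo X} {K : Set X} (hK : IsCompact K)
    (h : K ⊆ f.dom) : IsCompact (f.image K) := by
  have h1 : IsCompact ((↑) ⁻¹' K : Set f.dom) := by
    rw [Subtype.isCompact_iff]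
    convert hK using 1
    ext x
    constructor
    · rintro ⟨x, hx, rfl⟩
      exact hx
    · exact fun hx => ⟨⟨x, h hx⟩, hx, rfl⟩
  convert h1.image (continuous_subtype_val.comp f.toHomeomorph.continuous) using 1
  ext y
  simp [image]

/-- The domain is the preimage of `univ`, and in a T0 space a value is determined by its open
neighbourhoods; the image is then the set of values. -/
theorem ext_of_preimage {f g : PartialHomeo X} [T0Space X]
    (h : ∀ V, IsOpen V → f.preimage V = g.preimage V) : f = g := by
  have hd : f.dom = g.dom := by
    apply Opens.ext
    rw [← preimage_univ, ← preimage_univ, h _ isOpen_univ]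
  have hv : ∀ x (hf : x ∈ f.dom) (hg : x ∈ g.dom),
      (f.toHomeomorph ⟨x, hf⟩ : X) = g.toHomeomorph ⟨x, hg⟩ := by
    intro x hf hg
    refine (inseparable_iff_forall_isOpen.2 fun V hV => ?_).eq
    have := Set.ext_iff.1 (h V hV) x
    exact ⟨fun h1 => (this.1 ⟨hf, h1⟩).2, fun h1 => (this.2 ⟨hg, h1⟩).2⟩
  have hi : f.im = g.im := by
    ext y
    constructor
    · intro hy
      obtain ⟨x, hx⟩ := f.toHomeomorph.surjective ⟨y, hy⟩
      have hxg : (x : X) ∈ g.dom := hd.le x.2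
      have hyx : y = g.toHomeomorph ⟨x, hxg⟩ := by rw [← hv x x.2 hxg, hx]
      rw [hyx]
      exact (g.toHomeomorph _).2
    · intro hy
      obtain ⟨x, hx⟩ := g.toHomeomorph.surjective ⟨y, hy⟩
      have hxf : (x : X) ∈ f.dom := hd.ge x.2
      have hyx : y = f.toHomeomorph ⟨x, hxf⟩ := by rw [hv x hxf x.2, hx]
      rw [hyx]
      exact (f.toHomeomorph _).2
  obtain ⟨U, W, e⟩ := f
  obtain ⟨U', W', e'⟩ := g
  obtain rfl : U = U' := hd
  obtain rfl : W = W' := hi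
  congr 1
  ext x
  exact hv x x.2 x.2

end TopologicalSpace

/-! ### Codes and their axioms -/

variable [MetricSpace X] {B : Set (Set X)}

/-- The relation between basic sets which encodes `f`. -/
def code (B : Set (Set X)) (f : PartialHomeo X) (u v : B) : Prop :=
  closure (u : Set X) ⊆ f.preimage v

theorem preimage_eq_setOf_code (hB : IsLatticeBasis B) (f : PartialHomeo X) {V : Set X}
    (hV : IsOpen V) : f.preimage V = {x | ∃ u v : B, x ∈ (u : Set X) ∧ (v : Set X) ⊆ V ∧
      code B f u v} := by
  ext x
  constructor
  · rintro ⟨h, hx⟩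
    obtain ⟨v, hv, hxv, hvV⟩ := hB.basis.exists_subset_of_mem_open hx hV
    obtain ⟨u, hu, hxu, huv⟩ := hB.exists_between (isCompact_singleton (x := x))
      (f.isOpen_preimage (hB.basis.isOpen hv)) (by rintro _ rfl; exact ⟨h, hxv⟩)
    exact ⟨⟨u, hu⟩, ⟨v, hv⟩, hxu rfl, hvV, huv⟩
  · rintro ⟨u, v, hxu, hvV, huv⟩
    exact f.preimage_mono hvV (huv (subset_closure hxu))

/-- An open set is the union of the basic sets whose closures it contains. This turns inclusions
without closures into countable conjunctions of code conditions. -/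
theorem subset_preimage_iff_code (hB : IsLatticeBasis B) (f : PartialHomeo X) (u : Set X)
    (hu : IsOpen u) (v : B) :
    u ⊆ f.preimage v ↔ ∀ w : B, closure (w : Set X) ⊆ u → code B f w v := by
  constructor
  · exact fun h w hw => hw.trans h
  · intro h x hx
    obtain ⟨w, hw, hxw, hwu⟩ := hB.exists_between (isCompact_singleton (x := x)) hu
      (by rintro _ rfl; exact hx)
    exact h ⟨w, hw⟩ hwu (subset_closure (hxw rfl))

/-- The properties which characterize the codes of continuous partial maps with open domain. -/
structure IsCode (R : B → B → Prop) : Prop where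
  inter : ∀ u v v' w : B, (v : Set X) ∩ v' ⊆ w → R u v → R u v' → R u w
  union : ∀ u u' w v : B, (w : Set X) ⊆ u ∪ u' → R u v → R u' v → R w v
  empty_left : ∀ u v : B, (u : Set X) = ∅ → R u v
  empty_right : ∀ u v : B, (v : Set X) = ∅ → R u v → (u : Set X) = ∅
  interpolate : ∀ u v : B, R u v →
    ∃ u' v' : B, (closure (u : Set X) ⊆ u' ∧ closure (v' : Set X) ⊆ v) ∧ R u' v'
  split : ∀ u v v₁ v₂ : B, (v : Set X) ⊆ v₁ ∪ v₂ → R u v →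
    ∃ u₁ u₂ : B, (u : Set X) ⊆ u₁ ∪ u₂ ∧ R u₁ v₁ ∧ R u₂ v₂

/-- The properties which make the partial maps coded by `R` and `T` left inverse to each other. -/
structure IsLeftInverseCode (R T : B → B → Prop) : Prop where
  mapsTo : ∀ u w : B, R u w → ∃ v w' : B, R u v ∧ T v w'
  leftInverse : ∀ u v w : B, R u v → T v w → (u : Set X) ⊆ w

theorem isCode_code [CompactSpace X] (hB : IsLatticeBasis B) (f : PartialHomeo X) : IsCode (code B f) where
  inter u v v' w h h1 h2 :=
    (subset_inter h1 h2).trans ((f.preimage_inter _ _).ge.trans (f.preimage_mono h))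
  union u u' w v h h1 h2 := by
    refine (closure_mono h).trans ?_
    rw [closure_union]
    exact union_subset h1 h2
  empty_left u v h := by simp [code, h]
  empty_right u v h h1 := by
    rw [code, h, preimage_empty] at h1
    exact subset_empty_iff.1 (subset_closure.trans h1)
  interpolate u v h := by
    have hd : closure (u : Set X) ⊆ f.dom := fun x hx => (h hx).1
    obtain ⟨v', hv', h1, h2⟩ := hB.exists_between (isCompact_image isClosed_closure.isCompact hd)
      (hB.basis.isOpen v.2) ((image_subset_iff hd).2 h)
    obtain ⟨u', hu', h3, h4⟩ := hB.exists_between isClosed_closure.isCompact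
      (f.isOpen_preimage (hB.basis.isOpen hv')) ((image_subset_iff hd).1 h1)
    exact ⟨⟨u', hu'⟩, ⟨v', hv'⟩, ⟨h3, h2⟩, h4⟩
  split u v v₁ v₂ h h1 := by
    -- A compact set covered by two open sets is a union of two compact pieces, one in each; each
    -- piece is then thickened to a basic set.
    obtain ⟨K₁, K₂, hK₁, hK₂, h₁, h₂, hK⟩ :=
      (isClosed_closure (s := (u : Set X))).isCompact.binary_compact_cover
      (f.isOpen_preimage (hB.basis.isOpen v₁.2)) (f.isOpen_preimage (hB.basis.isOpen v₂.2))
      (by rw [← preimage_union]; exact h1.trans (f.preimage_mono h))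
    obtain ⟨u₁, hu₁, h₁, h₁'⟩ := hB.exists_between hK₁
      (f.isOpen_preimage (hB.basis.isOpen v₁.2)) h₁
    obtain ⟨u₂, hu₂, h₂, h₂'⟩ := hB.exists_between hK₂
      (f.isOpen_preimage (hB.basis.isOpen v₂.2)) h₂
    exact ⟨⟨u₁, hu₁⟩, ⟨u₂, hu₂⟩, subset_closure.trans (hK.le.trans (union_subset_union h₁ h₂)),
      h₁', h₂'⟩

theorem isLeftInverseCode_code [CompactSpace X] (hB : IsLatticeBasis B) (f : PartialHomeo X) :
    IsLeftInverseCode (code B f) (code B f.symm) where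
  mapsTo u w h := by
    have hd : closure (u : Set X) ⊆ f.dom := fun x hx => (h hx).1
    obtain ⟨v, hv, h1, h2⟩ := hB.exists_between (isCompact_image isClosed_closure.isCompact hd)
      f.im.isOpen (by rintro _ ⟨x, -, rfl⟩; exact (f.toHomeomorph x).2)
    exact ⟨⟨v, hv⟩, ⟨univ, hB.univ_mem⟩, (image_subset_iff hd).1 h1,
      by rw [code, preimage_univ]; exact h2⟩
  leftInverse u v w h1 h2 x hx := by
    obtain ⟨hd, h⟩ := h1 (subset_closure hx)
    obtain ⟨hd', h'⟩ := h2 (subset_closure h)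
    change (f.toHomeomorph.symm (f.toHomeomorph ⟨x, hd⟩) : X) ∈ (w : Set X) at h'
    rwa [f.toHomeomorph.symm_apply_apply] at h'

/-! ### Decoding: from an abstract code to a partial homeomorphism -/

namespace IsCode

variable {R T : B → B → Prop}

/-- The preimage of `v` under the partial map coded by `R`. -/
def preimage (R : B → B → Prop) (v : B) : Set X :=
  {x | ∃ u : B, x ∈ (u : Set X) ∧ R u v}

theorem isOpen_preimage (hB : IsLatticeBasis B) (R : B → B → Prop) (v : B) :
    IsOpen (preimage R v) := by
  refine isOpen_iff_forall_mem_open.2 ?_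
  rintro x ⟨u, hxu, hu⟩
  exact ⟨u, fun y hy => ⟨u, hy, hu⟩, hB.basis.isOpen u.2, hxu⟩

theorem mono_left (hR : IsCode R) {u u' v : B} (h : (u' : Set X) ⊆ u) (hu : R u v) : R u' v :=
  hR.union u u u' v (by simpa using h) hu hu

theorem mono_right (hR : IsCode R) {u v v' : B} (h : (v : Set X) ⊆ v') (hu : R u v) : R u v' :=
  hR.inter u v v v' (by simpa using h) hu hu

theorem preimage_mono (hR : IsCode R) {v v' : B} (h : (v : Set X) ⊆ v') :
    preimage R v ⊆ preimage R v' :=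
  fun _ ⟨u, hxu, hu⟩ => ⟨u, hxu, hR.mono_right h hu⟩

theorem exists_of_compact_subset (hB : IsLatticeBasis B) (hR : IsCode R) {v : B} {K : Set X}
    (hK : IsCompact K) (h : K ⊆ preimage R v) : ∃ u : B, K ⊆ u ∧ R u v := by
  refine hK.induction_on (p := fun s => ∃ u : B, s ⊆ u ∧ R u v)
    ⟨⟨∅, hB.empty_mem⟩, Subset.rfl, hR.empty_left _ _ rfl⟩ ?_ ?_ ?_
  · rintro s t hst ⟨u, hu, h1⟩
    exact ⟨u, hst.trans hu, h1⟩
  · rintro s t ⟨u, hu, h1⟩ ⟨u', hu', h1'⟩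
    exact ⟨⟨u ∪ u', hB.union_mem _ u.2 _ u'.2⟩, union_subset_union hu hu',
      hR.union u u' _ v Subset.rfl h1 h1'⟩
  · intro x hx
    obtain ⟨u, hxu, hu⟩ := h hx
    exact ⟨u, mem_nhdsWithin_of_mem_nhds (hB.basis.mem_nhds u.2 hxu), u, Subset.rfl, hu⟩

/-- Interpolation supplies room for the closure; conversely, finitely many related basic sets cover
the compact closure and `union` merges them. -/
theorem iff_closure_subset [CompactSpace X] (hB : IsLatticeBasis B) (hR : IsCode R) (u v : B) :
    R u v ↔ closure (u : Set X) ⊆ preimage R v := by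
  constructor
  · intro h x hx
    obtain ⟨u', v', ⟨h1, h2⟩, h3⟩ := hR.interpolate u v h
    exact ⟨u', h1 hx, hR.mono_right (subset_closure.trans h2) h3⟩
  · intro h
    obtain ⟨u', h1, h2⟩ := exists_of_compact_subset hB hR isClosed_closure.isCompact h
    exact hR.mono_left (subset_closure.trans h1) h2

/-- The partial map coded by `R` has a value at every point of its domain. -/
theorem exists_value [CompactSpace X] (hB : IsLatticeBasis B) (hR : IsCode R) {x : X} {w : B}
    (hx : x ∈ preimage R w) : ∃ y, ∀ v : B, y ∈ (v : Set X) ↔ x ∈ preimage R v := by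
  let ι := {v : B // x ∈ preimage R v}
  have : Nonempty ι := ⟨⟨w, hx⟩⟩
  have hinter : ∀ i j : ι, ∃ k : ι, (k.1 : Set X) = (i.1 : Set X) ∩ (j.1 : Set X) := by
    rintro ⟨v, u, hxu, hu⟩ ⟨v', u', hxu', hu'⟩
    refine ⟨⟨⟨v ∩ v', hB.inter_mem _ v.2 _ v'.2⟩, ⟨u ∩ u', hB.inter_mem _ u.2 _ u'.2⟩,
      ⟨hxu, hxu'⟩, hR.inter _ v v' _ Subset.rfl (hR.mono_left inter_subset_left hu)
        (hR.mono_left inter_subset_right hu')⟩, rfl⟩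
  -- The value is a point common to the closures of all `v` whose preimage contains `x`: a family
  -- directed by `inter`, with nonempty members by `empty_right`.
  have hne : (⋂ i : ι, closure (i.1 : Set X)).Nonempty := by
    refine IsCompact.nonempty_iInter_of_directed_nonempty_isCompact_isClosed _ ?_ ?_
      (fun i => isClosed_closure.isCompact) (fun i => isClosed_closure)
    · intro i j
      obtain ⟨k, hk⟩ := hinter i j
      refine ⟨k, ?_, ?_⟩
      · exact closure_mono (hk.le.trans inter_subset_left)
      · exact closure_mono (hk.le.trans inter_subset_right)
    · rintro ⟨v, u, hxu, hu⟩
      rw [closure_nonempty_iff, nonempty_iff_ne_empty]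
      intro h
      have := hR.empty_right u v h hu
      rw [this] at hxu
      exact hxu
  obtain ⟨y, hy⟩ := hne
  rw [mem_iInter] at hy
  refine ⟨y, fun v => ⟨fun hyv => ?_, ?_⟩⟩
  -- Here `v₂` contains the complement of `v` while its closure avoids `y`. As `v` and `v₂` cover
  -- `X`, `split` puts `x` in the preimage of one of them, and `v₂` is impossible by the choice of
  -- `y`.
  · obtain ⟨v₂, hv₂, h1, h2⟩ := hB.exists_between
      (hB.basis.isOpen v.2).isClosed_compl.isCompact (isOpen_compl_singleton (x := y))
      (fun z hz hzy => hz (by rwa [mem_singleton_iff.1 hzy]))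
    obtain ⟨u, hxu, hu⟩ := hx
    obtain ⟨u₁, u₂, h3, h4, h5⟩ := hR.split u w v ⟨v₂, hv₂⟩ (fun z _ => by
      by_cases hz : z ∈ (v : Set X)
      exacts [Or.inl hz, Or.inr (h1 hz)]) hu
    rcases h3 hxu with h | h
    · exact ⟨u₁, h, h4⟩
    · exact (h2 (hy ⟨⟨v₂, hv₂⟩, u₂, h, h5⟩) rfl).elim
  · rintro ⟨u, hxu, hu⟩
    -- Only the closures are known to contain `y`, so pass to a `v'` with closure inside `v`.
    obtain ⟨u', v', ⟨h1, h2⟩, h3⟩ := hR.interpolate u v hu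
    exact h2 (hy ⟨v', u', h1 (subset_closure hxu), h3⟩)

theorem leftInverse_of_isLeftInverseCode (hB : IsLatticeBasis B)
    (hRT : IsLeftInverseCode R T) {x y z : X}
    (hy : ∀ v : B, y ∈ (v : Set X) ↔ x ∈ preimage R v)
    (hz : ∀ v : B, z ∈ (v : Set X) ↔ y ∈ preimage T v) : z = x := by
  by_contra hne
  obtain ⟨w, hw, hzw, hwx⟩ := hB.basis.exists_subset_of_mem_open
    (show z ∈ ({x}ᶜ : Set X) from hne) isOpen_compl_singleton
  obtain ⟨v, hyv, hv⟩ := (hz ⟨w, hw⟩).1 hzw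
  obtain ⟨u, hxu, hu⟩ := (hy v).1 hyv
  exact hwx (hRT.leftInverse u v _ hu hv hxu) rfl

theorem mapsTo_of_isLeftInverseCode (hT : IsCode T) (hRT : IsLeftInverseCode R T) {x y : X}
    {w w' : B} (hw' : (w' : Set X) = univ) (hx : x ∈ preimage R w)
    (hy : ∀ v : B, y ∈ (v : Set X) ↔ x ∈ preimage R v) : y ∈ preimage T w' := by
  obtain ⟨u, hxu, hu⟩ := hx
  obtain ⟨v, w'', h1, h2⟩ := hRT.mapsTo u w hu
  exact ⟨v, (hy v).2 ⟨u, hxu, h1⟩, hT.mono_right (by simp [hw']) h2⟩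

theorem exists_code_eq [CompactSpace X] (hB : IsLatticeBasis B) (hR : IsCode R) (hT : IsCode T)
    (hRT : IsLeftInverseCode R T) (hTR : IsLeftInverseCode T R) :
    ∃ f : PartialHomeo X, code B f = R ∧ code B f.symm = T := by
  let t : B := ⟨univ, hB.univ_mem⟩
  choose f hf using fun x : preimage R t => exists_value hB hR x.2
  choose g hg using fun x : preimage T t => exists_value hB hT x.2
  have hfm : ∀ x, f x ∈ preimage T t := fun x => mapsTo_of_isLeftInverseCode hT hRT rfl x.2 (hf x)
  have hgm : ∀ x, g x ∈ preimage R t := fun x => mapsTo_of_isLeftInverseCode hR hTR rfl x.2 (hg x)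
  have hfc : Continuous f := hB.basis.continuous_iff.2 fun v hv => by
    convert (isOpen_preimage hB R ⟨v, hv⟩).preimage continuous_subtype_val using 1
    ext x
    exact hf x ⟨v, hv⟩
  have hgc : Continuous g := hB.basis.continuous_iff.2 fun v hv => by
    convert (isOpen_preimage hB T ⟨v, hv⟩).preimage continuous_subtype_val using 1
    ext x
    exact hg x ⟨v, hv⟩
  let e : (⟨preimage R t, isOpen_preimage hB R t⟩ : Opens X) ≃ₜ
      (⟨preimage T t, isOpen_preimage hB T t⟩ : Opens X) :=
    { toFun := fun x => ⟨f x, hfm x⟩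
      invFun := fun x => ⟨g x, hgm x⟩
      left_inv := fun x => Subtype.ext
        (leftInverse_of_isLeftInverseCode hB hRT (hf x) (hg ⟨f x, hfm x⟩))
      right_inv := fun x => Subtype.ext
        (leftInverse_of_isLeftInverseCode hB hTR (hg x) (hf ⟨g x, hgm x⟩))
      continuous_toFun := hfc.subtype_mk _
      continuous_invFun := hgc.subtype_mk _ }
  refine ⟨⟨_, _, e⟩, ?_, ?_⟩
  · ext u v
    rw [iff_closure_subset hB hR, code]
    refine iff_of_eq (congrArg _ (Set.ext fun x => ⟨?_, fun hx => ?_⟩))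
    · rintro ⟨h, hx⟩
      exact (hf ⟨x, h⟩ v).1 hx
    · have h : x ∈ preimage R t := hR.preimage_mono (subset_univ _) hx
      exact ⟨h, (hf ⟨x, h⟩ v).2 hx⟩
  · ext u v
    rw [iff_closure_subset hB hT, code]
    refine iff_of_eq (congrArg _ (Set.ext fun x => ⟨?_, fun hx => ?_⟩))
    · rintro ⟨h, hx⟩
      exact (hg ⟨x, h⟩ v).1 hx
    · have h : x ∈ preimage T t := hT.preimage_mono (subset_univ _) hx
      exact ⟨h, (hg ⟨x, h⟩ v).2 hx⟩

end IsCode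

/-! ### The set of codes is Borel -/

/-- The pair of relations which encodes `f` and `f⁻¹`. -/
def codePair (B : Set (Set X)) (f : PartialHomeo X) : (B → B → Prop) × (B → B → Prop) :=
  (code B f, code B f.symm)

/-- The first component already determines `f`; the second serves to describe the range and the sets
`⟨K; V⟩⁻¹`. -/
theorem codePair_injective (hB : IsLatticeBasis B) : Function.Injective (codePair B) := by
  intro f g h
  refine ext_of_preimage fun V hV => ?_
  rw [preimage_eq_setOf_code hB f hV, preimage_eq_setOf_code hB g hV,
    show code B f = code B g from congrArg Prod.fst h]

theorem range_codePair [CompactSpace X] (hB : IsLatticeBasis B) : range (codePair B) =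
    {p | (IsCode p.1 ∧ IsCode p.2) ∧ IsLeftInverseCode p.1 p.2 ∧ IsLeftInverseCode p.2 p.1} := by
  ext ⟨R, T⟩
  constructor
  · rintro ⟨f, hf⟩
    obtain ⟨rfl, rfl⟩ := Prod.ext_iff.1 hf
    exact ⟨⟨isCode_code hB f, isCode_code hB f.symm⟩, isLeftInverseCode_code hB f,
      isLeftInverseCode_code hB f.symm⟩
  · rintro ⟨⟨hR, hT⟩, hRT, hTR⟩
    obtain ⟨f, hf, hf'⟩ := IsCode.exists_code_eq hB hR hT hRT hTR
    exact ⟨f, Prod.ext hf hf'⟩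

theorem measurable_apply_apply {ι : Type*} (u v : ι) :
    Measurable fun R : ι → ι → Prop => R u v :=
  (measurable_pi_apply v).comp (measurable_pi_apply u)

theorem measurableSet_isCode [Countable B] : MeasurableSet {R : B → B → Prop | IsCode R} := by
  have h : {R : B → B → Prop | IsCode R} = {R |
      (∀ u v v' w : B, (v : Set X) ∩ v' ⊆ w → R u v → R u v' → R u w) ∧
      (∀ u u' w v : B, (w : Set X) ⊆ u ∪ u' → R u v → R u' v → R w v) ∧
      (∀ u v : B, (u : Set X) = ∅ → R u v) ∧
      (∀ u v : B, (v : Set X) = ∅ → R u v → (u : Set X) = ∅) ∧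
      (∀ u v : B, R u v →
        ∃ u' v' : B, (closure (u : Set X) ⊆ u' ∧ closure (v' : Set X) ⊆ v) ∧ R u' v') ∧
      (∀ u v v₁ v₂ : B, (v : Set X) ⊆ v₁ ∪ v₂ → R u v →
        ∃ u₁ u₂ : B, (u : Set X) ⊆ u₁ ∪ u₂ ∧ R u₁ v₁ ∧ R u₂ v₂)} := by
    ext R
    exact ⟨fun ⟨a, b, c, d, e, f⟩ => ⟨a, b, c, d, e, f⟩,
      fun ⟨a, b, c, d, e, f⟩ => ⟨a, b, c, d, e, f⟩⟩
  rw [h]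
  have m := measurable_apply_apply (ι := B)
  refine measurableSet_setOfPred.2 (.and ?_ (.and ?_ (.and ?_ (.and ?_ (.and ?_ ?_)))))
  · exact .forall fun u => .forall fun v => .forall fun v' => .forall fun w =>
      measurable_const.imp ((m _ _).imp ((m _ _).imp (m _ _)))
  · exact .forall fun u => .forall fun v => .forall fun v' => .forall fun w =>
      measurable_const.imp ((m _ _).imp ((m _ _).imp (m _ _)))
  · exact .forall fun u => .forall fun v => measurable_const.imp (m _ _)
  · exact .forall fun u => .forall fun v => measurable_const.imp ((m _ _).imp measurable_const)
  · exact .forall fun u => .forall fun v => (m _ _).imp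
      (.exists fun u' => .exists fun v' => measurable_const.and (m _ _))
  · exact .forall fun u => .forall fun v => .forall fun v₁ => .forall fun v₂ =>
      measurable_const.imp ((m _ _).imp
        (.exists fun u' => .exists fun v' => measurable_const.and ((m _ _).and (m _ _))))

omit [MetricSpace X] in
theorem measurableSet_isLeftInverseCode [Countable B] :
    MeasurableSet {p : (B → B → Prop) × (B → B → Prop) | IsLeftInverseCode p.1 p.2} := by
  have h : {p : (B → B → Prop) × (B → B → Prop) | IsLeftInverseCode p.1 p.2} = {p |
      (∀ u w : B, p.1 u w → ∃ v w' : B, p.1 u v ∧ p.2 v w') ∧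
      (∀ u v w : B, p.1 u v → p.2 v w → (u : Set X) ⊆ w)} := by
    ext R
    exact ⟨fun ⟨a, b⟩ => ⟨a, b⟩, fun ⟨a, b⟩ => ⟨a, b⟩⟩
  rw [h]
  have m₁ (u v : B) : Measurable fun p : (B → B → Prop) × (B → B → Prop) => p.1 u v :=
    (measurable_apply_apply u v).comp measurable_fst
  have m₂ (u v : B) : Measurable fun p : (B → B → Prop) × (B → B → Prop) => p.2 u v :=
    (measurable_apply_apply u v).comp measurable_snd
  refine measurableSet_setOfPred.2 (.and ?_ ?_)
  · exact .forall fun u => .forall fun w => (m₁ _ _).imp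
      (.exists fun u' => .exists fun v' => (m₁ _ _).and (m₂ _ _))
  · exact .forall fun u => .forall fun v => .forall fun w =>
      (m₁ _ _).imp ((m₂ _ _).imp measurable_const)

theorem measurableSet_range_codePair [CompactSpace X] (hB : IsLatticeBasis B) :
    MeasurableSet (range (codePair B)) := by
  have := hB.countable.to_subtype
  rw [range_codePair hB]
  exact ((measurableSet_isCode.preimage measurable_fst).inter
    (measurableSet_isCode.preimage measurable_snd)).inter
    (measurableSet_isLeftInverseCode.inter
      (measurableSet_isLeftInverseCode.preimage measurable_swap))

/-! ### Comparison of `τ_hco` with the σ-algebra of codes -/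

theorem isOpen_setOf_code [CompactSpace X] (hB : IsLatticeBasis B) (u v : B) :
    IsOpen {f : PartialHomeo X | code B f u v} := by
  refine (inf_le_left.trans inf_le_left : (tauHCO : TopologicalSpace (PartialHomeo X)) ≤ tauCO X) _
    (isOpen_generateFrom_of_mem (Or.inl ⟨closure u, v, isClosed_closure.isCompact,
      hB.basis.isOpen v.2, ?_⟩))
  ext f
  exact mem_compactOpen.symm

theorem isOpen_setOf_code_symm [CompactSpace X] (hB : IsLatticeBasis B) (u v : B) :
    IsOpen {f : PartialHomeo X | code B f.symm u v} := by
  refine (inf_le_left.trans inf_le_left : (tauHCO : TopologicalSpace (PartialHomeo X)) ≤ tauCO X) _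
    (isOpen_generateFrom_of_mem (Or.inr ⟨closure u, v, isClosed_closure.isCompact,
      hB.basis.isOpen v.2, ?_⟩))
  ext f
  exact mem_compactOpenInv.symm

/-- The coarsest σ-algebra for which the codes are measurable. -/
abbrev codeMeasurableSpace (B : Set (Set X)) : MeasurableSpace (PartialHomeo X) :=
  MeasurableSpace.comap (codePair B) inferInstance

theorem measurableSet_setOf_code (u v : B) :
    MeasurableSet[codeMeasurableSpace B] {f : PartialHomeo X | code B f u v} :=
  ⟨{p | p.1 u v}, measurableSet_setOfPred.2 ((measurable_apply_apply u v).comp measurable_fst), rfl⟩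

theorem measurableSet_setOf_code_symm (u v : B) :
    MeasurableSet[codeMeasurableSpace B] {f : PartialHomeo X | code B f.symm u v} :=
  ⟨{p | p.2 u v}, measurableSet_setOfPred.2 ((measurable_apply_apply u v).comp measurable_snd), rfl⟩

theorem measurableSet_setOf_subset_preimage (hB : IsLatticeBasis B) {u : Set X} (hu : IsOpen u)
    (v : B) : MeasurableSet[codeMeasurableSpace B] {f : PartialHomeo X | u ⊆ f.preimage v} := by
  have := hB.countable.to_subtype
  simp only [subset_preimage_iff_code hB _ u hu, ofPred_forall]
  exact .iInter fun w => .iInter fun _ => measurableSet_setOf_code w v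

theorem measurableSet_setOf_subset_preimage_symm (hB : IsLatticeBasis B) {u : Set X}
    (hu : IsOpen u) (v : B) :
    MeasurableSet[codeMeasurableSpace B] {f : PartialHomeo X | u ⊆ f.symm.preimage v} := by
  have := hB.countable.to_subtype
  simp only [subset_preimage_iff_code hB _ u hu, ofPred_forall]
  exact .iInter fun w => .iInter fun _ => measurableSet_setOf_code_symm w v

/-- A countable subbasis of a topology finer than `tauHCO`, consisting of sets measurable in
terms of the codes. -/
def codeSubbasis (B : Set (Set X)) : Set (Set (PartialHomeo X)) :=
  range (fun p : B × B => {f | code B f p.1 p.2}) ∪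
    range (fun p : B × B => {f | code B f.symm p.1 p.2}) ∪
    (range (fun v : B => {f | (v : Set X) ⊆ f.preimage univ}ᶜ) ∪
      range (fun v : B => {f | (v : Set X) ⊆ f.symm.preimage univ}ᶜ))

theorem exists_code_of_subset (hB : IsLatticeBasis B) {f : PartialHomeo X} {K V : Set X}
    (hK : IsCompact K) (hV : IsOpen V) (h : K ⊆ f.preimage V) :
    ∃ u v : B, K ⊆ u ∧ (v : Set X) ⊆ V ∧ code B f u v := by
  have hd : K ⊆ f.dom := fun x hx => (h hx).1
  obtain ⟨v, hv, h1, h2⟩ := hB.exists_between (isCompact_image hK hd) hV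
    ((image_subset_iff hd).2 h)
  obtain ⟨u, hu, h3, h4⟩ := hB.exists_between hK (f.isOpen_preimage (hB.basis.isOpen hv))
    ((image_subset_iff hd).1 h1)
  exact ⟨⟨u, hu⟩, ⟨v, hv⟩, h3, subset_closure.trans h2, h4⟩

theorem isOpen_setOf_subset_preimage (hB : IsLatticeBasis B) {K V : Set X} (hK : IsCompact K)
    (hV : IsOpen V) :
    IsOpen[generateFrom (codeSubbasis B)] {f : PartialHomeo X | K ⊆ f.preimage V} := by
  let _ := generateFrom (codeSubbasis B)
  have h : {f : PartialHomeo X | K ⊆ f.preimage V} =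
      ⋃ (u : B) (v : B) (_ : K ⊆ u ∧ (v : Set X) ⊆ V), {f | code B f u v} := by
    ext f
    simp only [mem_ofPred_eq, mem_iUnion, exists_prop]
    constructor
    · intro h
      obtain ⟨u, v, h1, h2, h3⟩ := exists_code_of_subset hB hK hV h
      exact ⟨u, v, ⟨h1, h2⟩, h3⟩
    · rintro ⟨u, v, ⟨h1, h2⟩, h3⟩
      exact (h1.trans subset_closure).trans (h3.trans (f.preimage_mono h2))
  rw [h]
  exact isOpen_iUnion fun u => isOpen_iUnion fun v => isOpen_iUnion fun _ =>
    isOpen_generateFrom_of_mem (Or.inl (Or.inl ⟨(u, v), rfl⟩))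

theorem isOpen_setOf_subset_preimage_symm (hB : IsLatticeBasis B) {K V : Set X}
    (hK : IsCompact K) (hV : IsOpen V) :
    IsOpen[generateFrom (codeSubbasis B)] {f : PartialHomeo X | K ⊆ f.symm.preimage V} := by
  let _ := generateFrom (codeSubbasis B)
  have h : {f : PartialHomeo X | K ⊆ f.symm.preimage V} =
      ⋃ (u : B) (v : B) (_ : K ⊆ u ∧ (v : Set X) ⊆ V), {f | code B f.symm u v} := by
    ext f
    simp only [mem_ofPred_eq, mem_iUnion, exists_prop]
    constructor
    · intro h
      obtain ⟨u, v, h1, h2, h3⟩ := exists_code_of_subset hB hK hV h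
      exact ⟨u, v, ⟨h1, h2⟩, h3⟩
    · rintro ⟨u, v, ⟨h1, h2⟩, h3⟩
      exact (h1.trans subset_closure).trans (h3.trans (f.symm.preimage_mono h2))
  rw [h]
  exact isOpen_iUnion fun u => isOpen_iUnion fun v => isOpen_iUnion fun _ =>
    isOpen_generateFrom_of_mem (Or.inl (Or.inr ⟨(u, v), rfl⟩))

theorem compl_inter_nonempty_iff (hB : IsLatticeBasis B) {U V : Set X} (hV : IsOpen V) :
    (Uᶜ ∩ V).Nonempty ↔ ∃ v : B, (v : Set X) ⊆ V ∧ ¬ (v : Set X) ⊆ U := by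
  constructor
  · rintro ⟨x, hxU, hxV⟩
    obtain ⟨v, hv, hxv, hvV⟩ := hB.basis.exists_subset_of_mem_open hxV hV
    exact ⟨⟨v, hv⟩, hvV, fun h => hxU (h hxv)⟩
  · rintro ⟨v, hvV, hvU⟩
    obtain ⟨x, hxv, hxU⟩ := not_subset.1 hvU
    exact ⟨x, hxU, hvV hxv⟩

/-- For the Fell part, `X \ dom f` meets `V` iff some basic `v ⊆ V` is not inside `dom f`, and `X \
dom f ⊆ W` iff the compact set `Wᶜ` lies in `dom f = f⁻¹[X]`. The same holds for `im f`. -/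
theorem generateFrom_codeSubbasis_le (hB : IsLatticeBasis B) :
    generateFrom (codeSubbasis B) ≤ (tauHCO : TopologicalSpace (PartialHomeo X)) := by
  refine le_inf (le_inf ?_ ?_) ?_
  · refine le_generateFrom ?_
    rintro _ (⟨K, V, hK, hV, rfl⟩ | ⟨K, V, hK, hV, rfl⟩)
    · convert isOpen_setOf_subset_preimage hB hK hV using 1
      ext f
      exact mem_compactOpen
    · convert isOpen_setOf_subset_preimage_symm hB hK hV using 1
      ext f
      exact mem_compactOpenInv
  · rw [induced_generateFrom_eq]
    refine le_generateFrom ?_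
    rintro _ ⟨_, ⟨V, hV, rfl⟩ | ⟨W, hW, hWc, rfl⟩, rfl⟩
    · have h : domCompl ⁻¹' {A : Closeds X | ((A : Set X) ∩ V).Nonempty} =
          ⋃ (v : B) (_ : (v : Set X) ⊆ V), {f | (v : Set X) ⊆ f.preimage univ}ᶜ := by
        ext f
        simpa [preimage_univ, domCompl] using compl_inter_nonempty_iff hB (U := f.dom) hV
      rw [h]
      let _ := generateFrom (codeSubbasis B)
      exact isOpen_iUnion fun v => isOpen_iUnion fun _ =>
        isOpen_generateFrom_of_mem (Or.inr (Or.inl ⟨v, rfl⟩))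
    · convert isOpen_setOf_subset_preimage hB hWc isOpen_univ using 1
      ext f
      simp [preimage_univ, domCompl, compl_subset_comm]
  · rw [induced_generateFrom_eq]
    refine le_generateFrom ?_
    rintro _ ⟨_, ⟨V, hV, rfl⟩ | ⟨W, hW, hWc, rfl⟩, rfl⟩
    · have h : imCompl ⁻¹' {A : Closeds X | ((A : Set X) ∩ V).Nonempty} =
          ⋃ (v : B) (_ : (v : Set X) ⊆ V), {f | (v : Set X) ⊆ f.symm.preimage univ}ᶜ := by
        ext f
        simpa [preimage_univ, imCompl, symm] using compl_inter_nonempty_iff hB (U := f.im) hV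
      rw [h]
      let _ := generateFrom (codeSubbasis B)
      exact isOpen_iUnion fun v => isOpen_iUnion fun _ =>
        isOpen_generateFrom_of_mem (Or.inr (Or.inr ⟨v, rfl⟩))
    · convert isOpen_setOf_subset_preimage_symm hB hWc isOpen_univ using 1
      ext f
      simp [preimage_univ, imCompl, symm, compl_subset_comm]

theorem countable_codeSubbasis (hB : IsLatticeBasis B) : (codeSubbasis B).Countable := by
  have := hB.countable.to_subtype
  exact ((countable_range _).union (countable_range _)).union
    ((countable_range _).union (countable_range _))

theorem borel_eq_codeMeasurableSpace [CompactSpace X] (hB : IsLatticeBasis B) :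
    borel (PartialHomeo X) = codeMeasurableSpace B := by
  apply le_antisymm
  · have hle : borel (PartialHomeo X) ≤ @borel _ (generateFrom (codeSubbasis B)) :=
      borel_anti (generateFrom_codeSubbasis_le hB)
    refine hle.trans ?_
    rw [@borel_eq_generateFrom_of_subbasis _ (codeSubbasis B) (generateFrom (codeSubbasis B))
      (@SecondCountableTopology.mk _ (generateFrom _) ⟨_, countable_codeSubbasis hB, rfl⟩) rfl]
    refine MeasurableSpace.generateFrom_le ?_
    rintro _ ((⟨p, rfl⟩ | ⟨p, rfl⟩) | ⟨v, rfl⟩ | ⟨v, rfl⟩)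
    · exact measurableSet_setOf_code _ _
    · exact measurableSet_setOf_code_symm _ _
    · exact (measurableSet_setOf_subset_preimage hB (hB.basis.isOpen v.2)
        ⟨univ, hB.univ_mem⟩).compl
    · exact (measurableSet_setOf_subset_preimage_symm hB (hB.basis.isOpen v.2)
        ⟨univ, hB.univ_mem⟩).compl
  · let _ := borel (PartialHomeo X)
    have : BorelSpace (PartialHomeo X) := ⟨rfl⟩
    rw [← measurable_iff_comap_le]
    refine (measurable_pi_iff.2 fun u => measurable_pi_iff.2 fun v => ?_).prodMk
      (measurable_pi_iff.2 fun u => measurable_pi_iff.2 fun v => ?_)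
    · exact measurableSet_setOfPred.1 (isOpen_setOf_code hB u v).measurableSet
    · exact measurableSet_setOfPred.1 (isOpen_setOf_code_symm hB u v).measurableSet

/-! ### Standard Borel structure and the subset `Γ(X, B)` -/

theorem standardBorelSpace_borel [CompactSpace X] (hB : IsLatticeBasis B) :
    @StandardBorelSpace (PartialHomeo X) (borel (PartialHomeo X)) := by
  have := hB.countable.to_subtype
  rw [borel_eq_codeMeasurableSpace hB]
  let _ := codeMeasurableSpace B
  have he : MeasurableEmbedding (codePair B) :=
    { injective := codePair_injective hB
      measurable := comap_measurable _
      measurableSet_image' := by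
        rintro _ ⟨t, ht, rfl⟩
        rw [image_preimage_eq_inter_range]
        exact ht.inter (measurableSet_range_codePair hB) }
  -- A Polish topology on the Borel range is transported back along the measurable isomorphism onto
  -- it; it need not be `τ_hco`.
  obtain ⟨τ, hτ, hτ'⟩ := (measurableSet_range_codePair hB).standardBorel.polish
  let e := he.equivRange
  refine @StandardBorelSpace.mk _ _ ⟨τ.induced e, @BorelSpace.mk _ (τ.induced e) _ ?_,
    e.toEquiv.polishSpace_induced⟩
  exact e.measurableEmbedding.comap_eq.symm.trans
    ((congrArg (MeasurableSpace.comap e) hτ.measurable_eq).trans borel_comap.symm)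

/-- For `u ⊆ dom f`, the equation `f[u] = w` splits into `u ⊆ f⁻¹[w]` and `w ⊆ f[u]`, both
code-measurable, so `f[u] ∈ B` becomes a quantifier over `w` in `B`. -/
theorem basePreserving_eq (B : Set (Set X)) : basePreserving B = {f : PartialHomeo X |
    ∀ u v : B, (u : Set X) ⊆ f.preimage univ → (v : Set X) ⊆ f.symm.preimage univ →
      (∃ w : B, (u : Set X) ⊆ f.preimage w ∧ (w : Set X) ⊆ f.symm.preimage u) ∧
      ∃ w : B, (v : Set X) ⊆ f.symm.preimage w ∧ (w : Set X) ⊆ f.preimage v} := by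
  have key : ∀ (f : PartialHomeo X) (u : Set X), u ⊆ f.dom →
      (f.image u ∈ B ↔ ∃ w : B, u ⊆ f.preimage w ∧ (w : Set X) ⊆ f.symm.preimage u) := by
    intro f u hu
    simp only [← image_subset_iff hu, ← image_eq_preimage_symm]
    constructor
    · exact fun h => ⟨⟨_, h⟩, Subset.rfl, Subset.rfl⟩
    · rintro ⟨w, h1, h2⟩
      rw [h1.antisymm h2]
      exact w.2
  ext f
  simp only [basePreserving, mem_ofPred_eq, preimage_univ, Subtype.forall]
  refine forall₂_congr fun u _ => forall₂_congr fun v _ => forall₂_congr fun hu hv => ?_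
  exact and_congr (key f u hu) (key f.symm v hv)

theorem measurableSet_basePreserving [CompactSpace X] (hB : IsLatticeBasis B) :
    MeasurableSet[borel (PartialHomeo X)] (basePreserving B) := by
  have := hB.countable.to_subtype
  rw [borel_eq_codeMeasurableSpace hB, basePreserving_eq]
  let _ := codeMeasurableSpace B
  have m₁ := fun u v : B => measurableSet_setOfPred.1
    (measurableSet_setOf_subset_preimage hB (hB.basis.isOpen u.2) v)
  have m₂ := fun u v : B => measurableSet_setOfPred.1
    (measurableSet_setOf_subset_preimage_symm hB (hB.basis.isOpen u.2) v)
  refine measurableSet_setOfPred.2 (.forall fun u => .forall fun v => .imp ?_ (.imp ?_ (.and ?_ ?_)))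
  · exact m₁ u ⟨univ, hB.univ_mem⟩
  · exact m₂ v ⟨univ, hB.univ_mem⟩
  · exact .exists fun w => (m₁ u w).and (m₂ w u)
  · exact .exists fun w => (m₂ v w).and (m₁ w v)

end PartialHomeo

theorem mainTheorem4 {X : Type*} [MetricSpace X] [CompactSpace X] (B : Set (Set X))
    (hB : TopologicalSpace.IsTopologicalBasis B) (hcount : B.Countable) (hempty : ∅ ∈ B)
    (hunion : ∀ u ∈ B, ∀ v ∈ B, u ∪ v ∈ B) (hinter : ∀ u ∈ B, ∀ v ∈ B, u ∩ v ∈ B) :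
    @StandardBorelSpace (PartialHomeo.basePreserving B)
      (borel (PartialHomeo.basePreserving B)) := by
  have h : IsLatticeBasis B := ⟨hB, hcount, hempty, hunion, hinter⟩
  let _ := borel (PartialHomeo X)
  have : BorelSpace (PartialHomeo X) := ⟨rfl⟩
  have : StandardBorelSpace (PartialHomeo X) := PartialHomeo.standardBorelSpace_borel h
  have hs := (PartialHomeo.measurableSet_basePreserving h).standardBorel
  rwa [(inferInstance : BorelSpace (PartialHomeo.basePreserving B)).measurable_eq] at hs
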